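/- Fix $c\in(0,1)$. For each $n\ge 0$, let $f:\{0,1\}^n\to[0,1]$ be chosen at random according to the uniform measure on $[0,1]^{\{0,1\}^n}$ (that is, the $2^n$ values of $f$ are independent and uniformly distributed on $[0,1]$). Call $f$ $c$-Lipschitz if changing any one coordinate of any $\mathbf{u}\in\{0,1\}^n$ changes the value $f(\mathbf{u})$ by at most $c$. Then, as $n\to\infty$, $$\mathbb{P}\left(f\text{ is }c\text{-Lipschitz}\right)=c^{2^n+o(2^n)}.$$ That is, there is a sequence $(e_n)_{n\ge0}$ of real numbers, depending only on $c$, with $e_n/2^n\to0$ as $n\to\infty$ and $\mathbb{P}(f\text{ is }c\text{-Lipschitz})=c^{2^n+e_n}$ for every $n\ge0$. -/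

import Mathlib

/-- The vertex set `{0,1}^n` of the `n`-dimensional hypercube. -/
abbrev Hypercube (n : ℕ) : Type := Fin n → Bool

/-- `f : {0,1}^n → [0,1]` is `c`-Lipschitz if changing one coordinate of the argument changes
the value of `f` by at most `c`. -/
def IsCubeLipschitz {n : ℕ} (c : ℝ) (f : Hypercube n → unitInterval) : Prop :=
  ∀ (u : Hypercube n) (i : Fin n) (b : Bool), |(f (Function.update u i b) : ℝ) - (f u : ℝ)| ≤ c

/-- The uniform probability measure on `[0,1]^({0,1}^n)`: the product, over the vertices of the
cube, of Lebesgue measure on `[0,1]`. -/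
noncomputable def uniformCubeMeasure (n : ℕ) :
    MeasureTheory.Measure (Hypercube n → unitInterval) :=
  MeasureTheory.Measure.pi fun _ => (MeasureTheory.volume : MeasureTheory.Measure unitInterval)

/-!
For a bipartite graph that is regular of degree `d`, the values on one side are independent once
those on the other side are given, and every vertex of the other side has `d` neighbours. Finner's
generalization of Hölder's inequality therefore bounds the probability of being `c`-Lipschitz by the
corresponding probability for the complete bipartite graph `K_{d,d}`, raised to the power
`|V| / 2d`. If the values on one side of `K_{d,d}` span an interval of length `w`, then those on the
other side lie in an interval of length at most `2c - w`, and `w (2c - w) ≤ c ^ 2`. Rounding the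
interval to a grid of mesh `1/d` leaves polynomially many choices, which disappear after taking the
`d`-th root, so the probability is at most `(c + o(1)) ^ |V|` as `d → ∞`. It is at least `c ^ |V|`,
since all values may lie in `[0,c]`. The hypercube is bipartite and regular of degree `n`.
-/

open Asymptotics Filter Finset MeasureTheory Topology
open scoped ENNReal

section Finner

variable {δ κ : Type*} [DecidableEq δ] {X : δ → Type*} [∀ i, MeasurableSpace (X i)]
  {μ : ∀ i, Measure (X i)}

theorem dependsOn_lmarginal {f : (∀ i, X i) → ℝ≥0∞} {N : Set δ} (hf : DependsOn f N)
    (s : Finset δ) : DependsOn (∫⋯∫⁻_s, f ∂μ) (N \ s) :=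
  fun _ _ h => lintegral_congr fun z => hf.updateFinset z h

theorem lmarginal_update_of_dependsOn {f : (∀ i, X i) → ℝ≥0∞} {N : Set δ} (hf : DependsOn f N)
    (s : Finset δ) {a : δ} (ha : a ∉ N) (x : ∀ i, X i) (y : X a) :
    (∫⋯∫⁻_s, f ∂μ) (Function.update x a y) = (∫⋯∫⁻_s, f ∂μ) x :=
  dependsOn_lmarginal hf s fun _ hi => Function.update_of_ne (ne_of_mem_of_not_mem hi.1 ha) _ _

theorem prod_lmarginal_update_rpow {B : Finset κ} {N : κ → Finset δ}
    {F : κ → (∀ i, X i) → ℝ≥0∞} (hF : ∀ b ∈ B, DependsOn (F b) (N b)) (p : κ → ℝ) (s : Finset δ)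
    (a : δ) (x : ∀ i, X i) (y : X a) :
    ∏ b ∈ B, (∫⋯∫⁻_s ∩ N b, F b ∂μ) (Function.update x a y) ^ p b =
      (∏ b ∈ B with a ∈ N b, (∫⋯∫⁻_s ∩ N b, F b ∂μ) (Function.update x a y) ^ p b) *
        ∏ b ∈ B with a ∉ N b, (∫⋯∫⁻_insert a s ∩ N b, F b ∂μ) x ^ p b := by
  rw [← prod_filter_mul_prod_filter_not B (a ∈ N ·)]
  congr 1
  refine prod_congr rfl fun b hb => ?_
  obtain ⟨hb, hab⟩ := mem_filter.1 hb
  rw [lmarginal_update_of_dependsOn (hF b hb) _ (mem_coe.not.2 hab), insert_inter_of_notMem hab]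

/-- **Finner's inequality**, obtained by applying Hölder's inequality to one variable at a time. -/
theorem lmarginal_prod_rpow_le [∀ i, SigmaFinite (μ i)] (s : Finset δ) {B : Finset κ}
    {N : κ → Finset δ} {F : κ → (∀ i, X i) → ℝ≥0∞} (hFm : ∀ b ∈ B, Measurable (F b))
    (hF : ∀ b ∈ B, DependsOn (F b) (N b)) {p : κ → ℝ} (hp0 : ∀ b ∈ B, 0 ≤ p b)
    (hp : ∀ a ∈ s, ∑ b ∈ B with a ∈ N b, p b = 1) (x : ∀ i, X i) :
    (∫⋯∫⁻_s, (fun x => ∏ b ∈ B, F b x ^ p b) ∂μ) x ≤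
      ∏ b ∈ B, (∫⋯∫⁻_s ∩ N b, F b ∂μ) x ^ p b := by
  induction s using Finset.induction generalizing x with
  | empty => simp
  | insert a s ha ih =>
    have hmeas : ∀ b ∈ B, Measurable fun y => (∫⋯∫⁻_s ∩ N b, F b ∂μ) (Function.update x a y) :=
      fun b hb => ((hFm b hb).lmarginal μ).comp (measurable_update x)
    calc (∫⋯∫⁻_insert a s, (fun x => ∏ b ∈ B, F b x ^ p b) ∂μ) x
        = ∫⁻ y, (∫⋯∫⁻_s, (fun x => ∏ b ∈ B, F b x ^ p b) ∂μ) (Function.update x a y) ∂μ a :=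
          lmarginal_insert _ (measurable_fun_prod _ fun b hb => (hFm b hb).pow_const _) ha x
      _ ≤ ∫⁻ y, ∏ b ∈ B, (∫⋯∫⁻_s ∩ N b, F b ∂μ) (Function.update x a y) ^ p b ∂μ a :=
          lintegral_mono fun y => ih (fun i hi => hp i (mem_insert_of_mem hi)) _
      _ = (∫⁻ y, ∏ b ∈ B with a ∈ N b, (∫⋯∫⁻_s ∩ N b, F b ∂μ) (Function.update x a y) ^ p b ∂μ a) *
          ∏ b ∈ B with a ∉ N b, (∫⋯∫⁻_insert a s ∩ N b, F b ∂μ) x ^ p b := by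
          rw [lintegral_congr (prod_lmarginal_update_rpow hF p s a x),
            lintegral_mul_const _ (measurable_fun_prod _ fun b hb =>
              (hmeas b (mem_of_mem_filter b hb)).pow_const _)]
      _ ≤ (∏ b ∈ B with a ∈ N b,
            (∫⁻ y, (∫⋯∫⁻_s ∩ N b, F b ∂μ) (Function.update x a y) ∂μ a) ^ p b) *
          ∏ b ∈ B with a ∉ N b, (∫⋯∫⁻_insert a s ∩ N b, F b ∂μ) x ^ p b := by
          gcongr
          exact ENNReal.lintegral_prod_norm_pow_le _
            (fun b hb => (hmeas b (mem_of_mem_filter b hb)).aemeasurable)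
            (hp a (mem_insert_self a s)) fun b hb => hp0 b (mem_of_mem_filter b hb)
      _ = ∏ b ∈ B, (∫⋯∫⁻_insert a s ∩ N b, F b ∂μ) x ^ p b := by
          rw [← prod_filter_mul_prod_filter_not B (a ∈ N ·)]
          congr 1
          refine prod_congr rfl fun b hb => ?_
          obtain ⟨hb, hab⟩ := mem_filter.1 hb
          rw [insert_inter_of_mem hab, lmarginal_insert _ (hFm b hb) fun h => ha (mem_inter.1 h).1]

end Finner

section Homomorphisms

variable {V X : Type*} [MeasurableSpace X] (ν : Measure X) {R : Set (X × X)}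

theorem measurable_measure_forall_mem [SFinite ν] {ι : Type*} [Countable ι]
    (hR : MeasurableSet R) :
    Measurable fun z : ι → X => ν {y | ∀ i, (y, z i) ∈ R} := by
  have hset : MeasurableSet {q : (ι → X) × X | ∀ i, (q.2, q.1 i) ∈ R} := by
    rw [Set.ofPred_forall]
    exact MeasurableSet.iInter fun i =>
      (measurable_snd.prodMk ((measurable_pi_apply i).comp measurable_fst)) hR
  exact measurable_measure_prodMk_left hset

/-- The total `ν`-mass of the maps from the complete bipartite graph with both sides indexed by
`ι` to `X` that send every edge into the relation `R`. The values on the second side are integrated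
out: given the values `z` on the first side, each of them contributes one factor. -/
noncomputable def bicliqueMass (R : Set (X × X)) (ι : Type*) [Fintype ι] : ℝ≥0∞ :=
  ∫⁻ z : ι → X, ν {y | ∀ i, (y, z i) ∈ R} ^ Fintype.card ι ∂Measure.pi fun _ => ν

theorem bicliqueMass_congr [SigmaFinite ν] {ι κ : Type*} [Fintype ι] [Fintype κ] (e : ι ≃ κ) :
    bicliqueMass ν R ι = bicliqueMass ν R κ := by
  unfold bicliqueMass
  have hmap := (measurePreserving_piCongrLeft (fun _ : κ => ν) e).lintegral_map_equiv
    fun z => ν {y | ∀ j, (y, z j) ∈ R} ^ Fintype.card κ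
  rw [hmap, Fintype.card_congr e]
  refine lintegral_congr fun z => ?_
  simp only [MeasurableEquiv.coe_piCongrLeft, ← e.forall_congr_right (q := fun j =>
    (_, Equiv.piCongrLeft (fun _ => X) e z j) ∈ R), Equiv.piCongrLeft_apply_apply]

theorem measurableSet_forall_mem (hR : MeasurableSet R) (b : V) (N : Finset V) :
    MeasurableSet {f : V → X | ∀ a ∈ N, (f b, f a) ∈ R} := by
  simp only [Set.ofPred_forall]
  exact N.measurableSet_biInter fun a _ =>
    ((measurable_pi_apply b).prodMk (measurable_pi_apply a)) hR

variable [DecidableEq V]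

theorem lmarginal_measure_forall_mem_pow (N : Finset V) (x : V → X) :
    (∫⋯∫⁻_N, (fun x => ν {y | ∀ a ∈ N, (y, x a) ∈ R} ^ #N) ∂fun _ => ν) x =
      bicliqueMass ν R N := by
  unfold bicliqueMass lmarginal
  rw [Fintype.card_coe]
  refine lintegral_congr fun z => ?_
  have hset : {y | ∀ a ∈ N, (y, Function.updateFinset x N z a) ∈ R} =
      {y | ∀ i : N, (y, z i) ∈ R} := by
    ext y
    simp +contextual [Function.updateFinset]
  exact congrArg (ν · ^ #N) hset

variable [SigmaFinite ν]

theorem lmarginal_prod_measure_forall_mem_le (hR : MeasurableSet R) {s t : Finset V}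
    {N : V → Finset V} (hNs : ∀ b ∈ t, N b ⊆ s) {d : ℕ} (hd : 0 < d) (hcard : ∀ b ∈ t, #(N b) = d)
    (hcard' : ∀ a ∈ s, #{b ∈ t | a ∈ N b} = d) (x : V → X) :
    (∫⋯∫⁻_s, (fun x => ∏ b ∈ t, ν {y | ∀ a ∈ N b, (y, x a) ∈ R}) ∂fun _ => ν) x ≤
      bicliqueMass ν R (Fin d) ^ (#t / d : ℝ) := by
  have hd' : (d : ℝ) ≠ 0 := by positivity
  let T (b : V) (x : V → X) : ℝ≥0∞ := ν {y | ∀ a ∈ N b, (y, x a) ∈ R}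
  have hT : ∀ b, Measurable (T b) := fun b => by
    have := (measurable_measure_forall_mem ν (ι := N b) hR).comp
      (Finset.measurable_restrict (X := fun _ => X) (N b))
    simpa [Function.comp_def] using this
  have hTdep : ∀ b, DependsOn (T b) (N b) := fun b x x' h => by
    have : ∀ y, (∀ a ∈ N b, (y, x a) ∈ R) ↔ ∀ a ∈ N b, (y, x' a) ∈ R := fun y =>
      forall₂_congr fun a ha => by rw [h a ha]
    simp only [T, this]
  calc (∫⋯∫⁻_s, (fun x => ∏ b ∈ t, T b x) ∂fun _ => ν) x
      = (∫⋯∫⁻_s, (fun x => ∏ b ∈ t, (T b x ^ d) ^ (1 / d : ℝ)) ∂fun _ => ν) x := by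
        simp only [one_div, ENNReal.pow_rpow_inv_natCast hd.ne']
    _ ≤ ∏ b ∈ t, (∫⋯∫⁻_s ∩ N b, (fun x => T b x ^ d) ∂fun _ => ν) x ^ (1 / d : ℝ) := by
        refine lmarginal_prod_rpow_le s (fun b _ => (hT b).pow_const d)
          (fun b _ _ _ h => congrArg (· ^ d) (hTdep b h)) (fun _ _ => by positivity)
          (fun a ha => ?_) x
        rw [sum_const, hcard' a ha, nsmul_eq_mul, mul_one_div_cancel hd']
    _ = ∏ _b ∈ t, bicliqueMass ν R (Fin d) ^ (1 / d : ℝ) := by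
        refine prod_congr rfl fun b hb => ?_
        rw [inter_eq_right.2 (hNs b hb), ← hcard b hb, lmarginal_measure_forall_mem_pow,
          bicliqueMass_congr ν (equivFin _)]
    _ = bicliqueMass ν R (Fin d) ^ (#t / d : ℝ) := by
        rw [prod_const, ← ENNReal.rpow_mul_natCast, one_div_mul_eq_div]

theorem lmarginal_prod_indicator_forall_mem_le (hR : MeasurableSet R) {t : Finset V}
    {N : V → Finset V} (hNt : ∀ b ∈ t, Disjoint (N b) t) (x : V → X) :
    (∫⋯∫⁻_t, (fun f => ∏ b ∈ t, {f : V → X | ∀ a ∈ N b, (f b, f a) ∈ R}.indicator 1 f)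
      ∂fun _ => ν) x ≤ ∏ b ∈ t, ν {y | ∀ a ∈ N b, (y, x a) ∈ R} := by
  let S (b : V) : Set (V → X) := {f | ∀ a ∈ N b, (f b, f a) ∈ R}
  have hS : ∀ b, MeasurableSet (S b) := fun b => measurableSet_forall_mem hR b (N b)
  have hSdep : ∀ b, DependsOn ((S b).indicator (1 : (V → X) → ℝ≥0∞))
      (insert b (N b) : Finset V) := fun b f f' h => by
    have hmem : f ∈ S b ↔ f' ∈ S b := forall₂_congr fun a ha => by
      rw [h b (mem_insert_self b _), h a (mem_insert_of_mem ha)]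
    by_cases hf : f ∈ S b
    · rw [Set.indicator_of_mem hf, Set.indicator_of_mem (hmem.1 hf), Pi.one_apply, Pi.one_apply]
    · rw [Set.indicator_of_notMem hf, Set.indicator_of_notMem (mt hmem.2 hf)]
  have hself : ∀ b ∈ t, {a ∈ t | b ∈ insert a (N a)} = {b} := fun b hb => by
    ext a
    simp only [mem_filter, mem_insert, mem_singleton]
    refine ⟨fun ⟨ha, h⟩ => ?_, fun h => ⟨h ▸ hb, .inl h.symm⟩⟩
    exact (h.resolve_right fun hba => disjoint_left.1 (hNt a ha) hba hb).symm
  have hmarginal : ∀ b ∈ t, (∫⋯∫⁻_t ∩ insert b (N b), (S b).indicator 1 ∂fun _ => ν) x =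
      ν {y | ∀ a ∈ N b, (y, x a) ∈ R} := fun b hb => by
    have hb' : b ∉ N b := fun h => disjoint_left.1 (hNt b hb) h hb
    have hslice : Function.update x b ⁻¹' S b = {y | ∀ a ∈ N b, (y, x a) ∈ R} :=
      Set.ext fun y => forall₂_congr fun a ha => by
        rw [Function.update_self, Function.update_of_ne (ne_of_mem_of_not_mem ha hb')]
    rw [inter_insert_of_mem hb, disjoint_iff_inter_eq_empty.1 (hNt b hb).symm, insert_empty_eq,
      lmarginal_singleton, ← hslice, ← lintegral_indicator_one (measurable_update x (hS b))]
    rfl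
  have := lmarginal_prod_rpow_le (μ := fun _ => ν) t (fun b _ => measurable_one.indicator (hS b))
    (fun b _ => hSdep b) (p := 1) (fun _ _ => zero_le_one)
    (fun a ha => by rw [hself a ha, sum_singleton, Pi.one_apply]) x
  simpa only [Pi.one_apply, ENNReal.rpow_one, prod_congr rfl hmarginal] using this

end Homomorphisms

section RegularBipartite

variable {V : Type*} [Fintype V] {G : SimpleGraph V} [DecidableRel G.Adj] {d : ℕ}

theorem union_eq_univ_of_isBipartiteWith [DecidableEq V] {s t : Finset V}
    (hst : G.IsBipartiteWith s t) (hdeg : G.IsRegularOfDegree d) (hd : 0 < d) :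
    s ∪ t = univ := by
  refine eq_univ_of_forall fun v => ?_
  obtain ⟨w, hvw⟩ := (G.degree_pos_iff_exists_adj v).1 (by rwa [hdeg.degree_eq])
  have := hst.mem_of_adj hvw
  simp only [mem_coe] at this
  rw [mem_union]
  tauto

theorem two_mul_card_eq_of_isBipartiteWith {s t : Finset V} (hst : G.IsBipartiteWith s t)
    (hdeg : G.IsRegularOfDegree d) (hd : 0 < d) : 2 * #t = Fintype.card V := by
  classical
  have hcard : #s = #t := by
    have := SimpleGraph.isBipartiteWith_sum_degrees_eq hst
    simp only [hdeg.degree_eq, sum_const, smul_eq_mul] at this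
    exact Nat.eq_of_mul_eq_mul_right hd this
  rw [← card_univ, ← union_eq_univ_of_isBipartiteWith hst hdeg hd,
    card_union_of_disjoint (disjoint_coe.1 hst.disjoint), hcard, two_mul]

theorem measure_forall_adj_mem_le_lintegral_prod {X : Type*} [MeasurableSpace X] {R : Set (X × X)}
    (hR : MeasurableSet R) (μ : Measure (V → X)) (t : Finset V) :
    μ {f | ∀ u v, G.Adj u v → (f u, f v) ∈ R} ≤
      ∫⁻ f, ∏ b ∈ t, {f : V → X | ∀ a ∈ G.neighborFinset b, (f b, f a) ∈ R}.indicator 1 f ∂μ := by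
  let S (b : V) : Set (V → X) := {f | ∀ a ∈ G.neighborFinset b, (f b, f a) ∈ R}
  have hone : ∀ f : V → X, (∀ u v, G.Adj u v → (f u, f v) ∈ R) →
      ∏ b ∈ t, (S b).indicator (1 : (V → X) → ℝ≥0∞) f = 1 := fun f hf =>
    prod_eq_one fun b _ => Set.indicator_of_mem
      (show f ∈ S b from fun a ha => hf b a ((G.mem_neighborFinset b a).1 ha)) 1
  calc μ {f | ∀ u v, G.Adj u v → (f u, f v) ∈ R}
      ≤ μ {f | 1 ≤ ∏ b ∈ t, (S b).indicator (1 : (V → X) → ℝ≥0∞) f} :=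
        measure_mono fun f hf => (hone f hf).ge
    _ ≤ ∫⁻ f, ∏ b ∈ t, (S b).indicator 1 f ∂μ := by
        simpa only [one_mul] using mul_meas_ge_le_lintegral (measurable_fun_prod t fun b _ =>
          measurable_one.indicator (measurableSet_forall_mem hR b (G.neighborFinset b))) 1

theorem measure_pi_forall_adj_mem_le {X : Type*} [MeasurableSpace X] (ν : Measure X)
    [SigmaFinite ν] {R : Set (X × X)} (hR : MeasurableSet R) (hG : G.IsBipartite)
    (hdeg : G.IsRegularOfDegree d) (hd : 0 < d) :
    Measure.pi (fun _ : V => ν) {f | ∀ u v, G.Adj u v → (f u, f v) ∈ R} ≤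
      bicliqueMass ν R (Fin d) ^ (Fintype.card V / (2 * d) : ℝ) := by
  classical
  obtain ⟨s, t, hst⟩ : ∃ s t : Finset V, G.IsBipartiteWith s t := by
    obtain ⟨s, t, hst⟩ := hG.exists_isBipartiteWith
    exact ⟨s.toFinset, t.toFinset, by simpa only [Set.coe_toFinset] using hst⟩
  let S (b : V) : Set (V → X) := {f | ∀ a ∈ G.neighborFinset b, (f b, f a) ∈ R}
  have hS : ∀ b, MeasurableSet (S b) := fun b => measurableSet_forall_mem hR b _
  rcases isEmpty_or_nonempty (V → X) with hempty | ⟨⟨x⟩⟩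
  · simp only [Set.eq_empty_of_isEmpty, measure_empty, zero_le]
  calc Measure.pi (fun _ : V => ν) {f | ∀ u v, G.Adj u v → (f u, f v) ∈ R}
      ≤ ∫⁻ f, ∏ b ∈ t, (S b).indicator 1 f ∂Measure.pi fun _ => ν :=
        measure_forall_adj_mem_le_lintegral_prod hR _ t
    _ = (∫⋯∫⁻_s, ∫⋯∫⁻_t, (fun f => ∏ b ∈ t, (S b).indicator 1 f)
          ∂(fun _ => ν) ∂fun _ => ν) x := by
        rw [← lmarginal_union _ _ (measurable_fun_prod _ fun b _ =>
          measurable_one.indicator (hS b)) (disjoint_coe.1 hst.disjoint),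
          union_eq_univ_of_isBipartiteWith hst hdeg hd, lmarginal_univ]
    _ ≤ (∫⋯∫⁻_s, (fun x => ∏ b ∈ t, ν {y | ∀ a ∈ G.neighborFinset b, (y, x a) ∈ R})
          ∂fun _ => ν) x :=
        lmarginal_mono (fun x => lmarginal_prod_indicator_forall_mem_le ν hR (fun b hb =>
          SimpleGraph.isBipartiteWith_neighborFinset_disjoint' hst hb) x) x
    _ ≤ bicliqueMass ν R (Fin d) ^ (#t / d : ℝ) := by
        refine lmarginal_prod_measure_forall_mem_le ν hR
          (fun b hb => SimpleGraph.isBipartiteWith_neighborFinset_subset' hst hb) hd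
          (fun b _ => hdeg.degree_eq b) (fun a ha => ?_) x
        simp only [SimpleGraph.mem_neighborFinset, SimpleGraph.adj_comm _ _ a]
        rw [← SimpleGraph.isBipartiteWith_neighborFinset hst ha]
        exact hdeg.degree_eq a
    _ = bicliqueMass ν R (Fin d) ^ (Fintype.card V / (2 * d) : ℝ) := by
        rw [← two_mul_card_eq_of_isBipartiteWith hst hdeg hd, Nat.cast_mul, Nat.cast_two,
          mul_div_mul_left _ _ two_ne_zero]

end RegularBipartite

section Biclique

theorem bicliqueMass_le_of_cover {X κ ι : Type*} [MeasurableSpace X] [Fintype ι] (ν : Measure X)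
    [SigmaFinite ν] {R : Set (X × X)} (Q : Finset κ) {A B : κ → Set X}
    (hA : ∀ q ∈ Q, MeasurableSet (A q))
    (hcover : ∀ z : ι → X, ∃ q ∈ Q, (∀ i, z i ∈ A q) ∧ {y | ∀ i, (y, z i) ∈ R} ⊆ B q)
    {r : ℝ≥0∞} (hr : ∀ q ∈ Q, ν (A q) * ν (B q) ≤ r) :
    bicliqueMass ν R ι ≤ #Q * r ^ Fintype.card ι := by
  have hbox : ∀ q ∈ Q, MeasurableSet (Set.univ.pi fun _ : ι => A q) :=
    fun q hq => MeasurableSet.univ_pi fun _ => hA q hq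
  calc bicliqueMass ν R ι
      ≤ ∫⁻ z : ι → X, ∑ q ∈ Q, (Set.univ.pi fun _ => A q).indicator 1 z * ν (B q) ^ Fintype.card ι
          ∂Measure.pi fun _ => ν := by
        refine lintegral_mono fun z => ?_
        obtain ⟨q, hq, hz, hB⟩ := hcover z
        refine le_trans ?_ (single_le_sum (fun _ _ => zero_le) hq)
        rw [Set.indicator_of_mem (Set.mem_univ_pi.2 hz), Pi.one_apply, one_mul]
        gcongr
    _ = ∑ q ∈ Q, (ν (A q) * ν (B q)) ^ Fintype.card ι := by
        rw [lintegral_finsetSum _ fun q hq => (measurable_one.indicator (hbox q hq)).mul_const _]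
        refine sum_congr rfl fun q hq => ?_
        rw [lintegral_mul_const _ (measurable_one.indicator (hbox q hq)),
          lintegral_indicator_one (hbox q hq), Measure.pi_pi, prod_const, card_univ, mul_pow]
    _ ≤ ∑ _q ∈ Q, r ^ Fintype.card ι := sum_le_sum fun q hq => by gcongr; exact hr q hq
    _ = #Q * r ^ Fintype.card ι := by rw [sum_const, nsmul_eq_mul]

theorem volume_preimage_Icc_le (a b : ℝ) :
    volume (Subtype.val ⁻¹' Set.Icc a b : Set unitInterval) ≤ ENNReal.ofReal (b - a) := by
  rw [unitInterval.volume_apply, ← Real.volume_Icc]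
  exact measure_mono (Set.image_preimage_subset _ _)

theorem ofReal_mul_ofReal_le (a b : ℝ) :
    ENNReal.ofReal a * ENNReal.ofReal b ≤ ENNReal.ofReal (((a + b) / 2) ^ 2) := by
  rcases le_total a 0 with ha | ha
  · rw [ENNReal.ofReal_of_nonpos ha, zero_mul]
    exact zero_le
  · rw [← ENNReal.ofReal_mul ha]
    exact ENNReal.ofReal_le_ofReal (by linarith [four_mul_le_sq_add a b])

theorem exists_grid_cover {ι : Type*} [Finite ι] [Nonempty ι] (c : ℝ) {M : ℕ} (hM : 0 < M)
    (z : ι → unitInterval) :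
    ∃ q ∈ range (M + 1) ×ˢ range (M + 1),
      (∀ i, (z i : ℝ) ∈ Set.Icc (q.1 / M : ℝ) ((q.2 + 1) / M)) ∧
      ∀ y : ℝ, (∀ i, |y - z i| ≤ c) → y ∈ Set.Icc (q.2 / M - c) ((q.1 + 1) / M + c) := by
  have hM' : (0 : ℝ) < M := Nat.cast_pos.2 hM
  let k (i : ι) : ℕ := ⌊(z i : ℝ) * M⌋₊
  have hk : ∀ i, k i ∈ range (M + 1) := fun i =>
    mem_range_succ_iff.2 (Nat.floor_le_of_le (mul_le_of_le_one_left hM'.le (z i).2.2))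
  have hle : ∀ i, (k i / M : ℝ) ≤ z i := fun i =>
    (div_le_iff₀ hM').2 (Nat.floor_le (mul_nonneg (z i).2.1 hM'.le))
  have hge : ∀ i, (z i : ℝ) ≤ (k i + 1) / M := fun i =>
    (le_div_iff₀ hM').2 (Nat.lt_floor_add_one _).le
  obtain ⟨i, hi⟩ := Finite.exists_min fun i => (z i : ℝ)
  obtain ⟨j, hj⟩ := Finite.exists_max fun i => (z i : ℝ)
  refine ⟨(k i, k j), mk_mem_product (hk i) (hk j),
    fun l => ⟨(hle i).trans (hi l), (hj l).trans (hge j)⟩, fun y hy => ⟨?_, ?_⟩⟩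
  · linarith [(abs_le.1 (hy j)).1, hle j]
  · linarith [(abs_le.1 (hy i)).2, hge i]

theorem bicliqueMass_volume_le {ι : Type*} [Fintype ι] [Nonempty ι] (c : ℝ) {M : ℕ} (hM : 0 < M) :
    bicliqueMass volume {p : unitInterval × unitInterval | |(p.1 : ℝ) - p.2| ≤ c} ι ≤
      ENNReal.ofReal ((M + 1) ^ 2 * (c + 1 / M) ^ (2 * Fintype.card ι)) := by
  refine (bicliqueMass_le_of_cover volume (range (M + 1) ×ˢ range (M + 1))
    (A := fun q => Subtype.val ⁻¹' Set.Icc (q.1 / M : ℝ) ((q.2 + 1) / M))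
    (B := fun q => Subtype.val ⁻¹' Set.Icc (q.2 / M - c : ℝ) ((q.1 + 1) / M + c))
    (r := ENNReal.ofReal ((c + 1 / M) ^ 2)) (fun q _ => measurable_subtype_coe measurableSet_Icc)
    (fun z => ?_) fun q _ => ?_).trans_eq ?_
  · obtain ⟨q, hq, hz, hy⟩ := exists_grid_cover c hM z
    exact ⟨q, hq, hz, fun y => hy y⟩
  · refine (mul_le_mul' (volume_preimage_Icc_le _ _) (volume_preimage_Icc_le _ _)).trans
      ((ofReal_mul_ofReal_le _ _).trans_eq ?_)
    ring_nf
  · rw [card_product, card_range, ← sq, ENNReal.ofReal_mul (by positivity), pow_mul,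
      ENNReal.ofReal_pow (sq_nonneg _)]
    norm_cast

end Biclique

section LipschitzProb

/-- The probability that a random function on the vertices of the finite graph `G`, with
independent values uniformly distributed on `[0,1]`, changes by at most `c` along every edge. -/
noncomputable def lipschitzProb {V : Type*} [Fintype V] (G : SimpleGraph V) (c : ℝ) : ℝ :=
  (Measure.pi fun _ : V => (volume : Measure unitInterval)).real
    {f | ∀ u v, G.Adj u v → |(f u : ℝ) - f v| ≤ c}

variable {V : Type*} [Fintype V] (G : SimpleGraph V) {c : ℝ}

theorem pow_card_le_lipschitzProb (h0 : 0 ≤ c) (h1 : c ≤ 1) :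
    c ^ Fintype.card V ≤ lipschitzProb G c := by
  have hbox : (Measure.pi fun _ : V => (volume : Measure unitInterval)).real
      (Set.univ.pi fun _ => Set.Iic ⟨c, h0, h1⟩) = c ^ Fintype.card V := by
    simp only [measureReal_def, Measure.pi_pi, unitInterval.volume_Iic, prod_const, card_univ,
      ENNReal.toReal_pow, ENNReal.toReal_ofReal h0]
  rw [← hbox]
  refine measureReal_mono fun f hf u v _ => ?_
  have hle : ∀ w, (f w : ℝ) ≤ c := fun w => hf w (Set.mem_univ w)
  exact abs_sub_le_iff.2 ⟨by linarith [hle u, (f v).2.1], by linarith [hle v, (f u).2.1]⟩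

theorem lipschitzProb_le_pow_card {G : SimpleGraph V} [DecidableRel G.Adj] (hG : G.IsBipartite)
    {d : ℕ} (hdeg : G.IsRegularOfDegree d) (hd : 0 < d) (hc : 0 ≤ c) :
    lipschitzProb G c ≤ ((d + 1 : ℝ) ^ (1 / d : ℝ) * (c + 1 / d)) ^ Fintype.card V := by
  have : NeZero d := ⟨hd.ne'⟩
  have hR : MeasurableSet {p : unitInterval × unitInterval | |(p.1 : ℝ) - p.2| ≤ c} :=
    measurableSet_le (by fun_prop) measurable_const
  have hroot : (d + 1 : ℝ) ^ 2 * (c + 1 / d) ^ (2 * d) =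
      ((d + 1 : ℝ) ^ (1 / d : ℝ) * (c + 1 / d)) ^ (2 * d) := by
    rw [mul_pow, mul_comm 2 d, pow_mul (_ ^ _), one_div, Real.rpow_inv_natCast_pow (by positivity)
      hd.ne']
  have hbiclique := bicliqueMass_volume_le (ι := Fin d) c hd
  rw [Fintype.card_fin, hroot, ENNReal.ofReal_pow (by positivity)] at hbiclique
  refine ENNReal.toReal_le_of_le_ofReal (by positivity) ?_
  refine (measure_pi_forall_adj_mem_le volume hR hG hdeg hd).trans
    ((ENNReal.rpow_le_rpow hbiclique (by positivity)).trans_eq ?_)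
  rw [← ENNReal.rpow_natCast, ← ENNReal.rpow_mul, Nat.cast_mul, Nat.cast_two,
    mul_div_cancel₀ _ (by positivity), ENNReal.rpow_natCast, ENNReal.ofReal_pow (by positivity)]

end LipschitzProb

section Asymptotics

theorem tendsto_add_one_rpow_mul_add (c : ℝ) :
    Tendsto (fun d : ℕ => (d + 1 : ℝ) ^ (1 / d : ℝ) * (c + 1 / d)) atTop (𝓝 c) := by
  have hroot : Tendsto (fun d : ℕ => (d + 1 : ℝ) ^ (1 / d : ℝ)) atTop (𝓝 1) := by
    refine ((tendsto_rpow_div_mul_add 1 1 (-1) zero_ne_one).comp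
      (tendsto_atTop_add_const_right _ 1 tendsto_natCast_atTop_atTop)).congr fun d => ?_
    simp only [Function.comp_apply, one_mul, add_neg_cancel_right]
  simpa only [add_zero, one_mul] using
    hroot.mul (tendsto_one_div_atTop_nhds_zero_nat.const_add c)

theorem exists_isLittleO_eq_rpow_add {ι : Type*} {l : Filter ι} {P X : ι → ℝ} {N : ι → ℕ} {c : ℝ}
    (hc : c ∈ Set.Ioo (0 : ℝ) 1) (hlower : ∀ i, c ^ N i ≤ P i) (hupper : ∀ᶠ i in l, P i ≤ X i ^ N i)
    (hX : Tendsto X l (𝓝 c)) :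
    ∃ e : ι → ℝ, e =o[l] (fun i => (N i : ℝ)) ∧ ∀ i, P i = c ^ (N i + e i : ℝ) := by
  obtain ⟨h0, h1⟩ := hc
  have hlogc : Real.log c < 0 := Real.log_neg h0 h1
  have hP : ∀ i, 0 < P i := fun i => (pow_pos h0 _).trans_le (hlower i)
  have hlog : Tendsto (fun i => 1 - Real.log (X i) / Real.log c) l (𝓝 0) := by
    simpa only [div_self hlogc.ne, sub_self] using
      ((hX.log h0.ne').div_const (Real.log c)).const_sub 1
  refine ⟨fun i => Real.log (P i) / Real.log c - N i, ?_, fun i => ?_⟩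
  · have hbound : (fun i => Real.log (P i) / Real.log c - N i) =O[l]
        fun i => (1 - Real.log (X i) / Real.log c) * N i := by
      refine IsBigO.of_bound' ?_
      filter_upwards [hupper] with i hi
      have hle : Real.log (P i) / Real.log c ≤ N i := by
        rw [div_le_iff_of_neg hlogc, ← Real.log_pow]
        exact Real.log_le_log (pow_pos h0 _) (hlower i)
      have hge : N i * Real.log (X i) / Real.log c ≤ Real.log (P i) / Real.log c := by
        rw [div_le_div_right_of_neg hlogc, ← Real.log_pow]
        exact Real.log_le_log (hP i) hi
      rw [Real.norm_of_nonpos (sub_nonpos.2 hle)]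
      refine le_trans ?_ (le_abs_self _)
      linarith [mul_div_assoc (N i : ℝ) (Real.log (X i)) (Real.log c)]
    refine hbound.trans_isLittleO ?_
    simpa only [one_mul] using
      ((isLittleO_one_iff ℝ).2 hlog).mul_isBigO (isBigO_refl (fun i => (N i : ℝ)) l)
  · rw [add_sub_cancel, Real.rpow_def_of_pos h0, mul_div_cancel₀ _ hlogc.ne, Real.exp_log (hP i)]

theorem mainTheorem7_general {ι : Type*} {l : Filter ι} {V : ι → Type*} [∀ i, Fintype (V i)]
    {G : ∀ i, SimpleGraph (V i)} [∀ i, DecidableRel (G i).Adj] {d : ι → ℕ}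
    (hG : ∀ i, (G i).IsBipartite) (hdeg : ∀ i, (G i).IsRegularOfDegree (d i))
    (hd : Tendsto d l atTop) {c : ℝ} (hc : c ∈ Set.Ioo (0 : ℝ) 1) :
    ∃ e : ι → ℝ, e =o[l] (fun i => (Fintype.card (V i) : ℝ)) ∧
      ∀ i, lipschitzProb (G i) c = c ^ (Fintype.card (V i) + e i : ℝ) := by
  refine exists_isLittleO_eq_rpow_add hc (fun i => pow_card_le_lipschitzProb (G i) hc.1.le hc.2.le)
    ?_ ((tendsto_add_one_rpow_mul_add c).comp hd)
  filter_upwards [hd.eventually_gt_atTop 0] with i hi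
  exact lipschitzProb_le_pow_card (hG i) (hdeg i) hi hc.1.le

end Asymptotics

section Hypercube

variable {n : ℕ}

/-- The graph of the `n`-dimensional hypercube: two vertices are adjacent if flipping one
coordinate takes the first to the second. -/
def hypercubeGraph (n : ℕ) : SimpleGraph (Hypercube n) where
  Adj u v := ∃ i, Function.update u i (!u i) = v
  symm := ⟨by
    rintro u _ ⟨i, rfl⟩
    exact ⟨i, by simp⟩⟩
  loopless := ⟨fun u ⟨i, h⟩ => by simpa using congrFun h i⟩

instance : DecidableRel (hypercubeGraph n).Adj :=
  fun u v => inferInstanceAs (Decidable (∃ i, Function.update u i (!u i) = v))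

theorem hypercubeGraph_isRegularOfDegree : (hypercubeGraph n).IsRegularOfDegree n := by
  intro u
  have hinj : Function.Injective fun i => Function.update u i (!u i) := fun i j h => by
    by_contra hij
    simpa [Function.update_of_ne hij] using congrFun h i
  have hneighbors : (hypercubeGraph n).neighborFinset u =
      univ.image fun i => Function.update u i (!u i) := by
    ext v
    simp only [SimpleGraph.mem_neighborFinset, mem_image, mem_univ, true_and]
    rfl
  rw [← SimpleGraph.card_neighborFinset_eq_degree, hneighbors, card_image_of_injective _ hinj,
    card_univ, Fintype.card_fin]

theorem hypercubeGraph_isBipartite : (hypercubeGraph n).IsBipartite := by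
  let parity (u : Hypercube n) : ZMod 2 := ∑ i, if u i then 1 else 0
  have hflip : ∀ u i, parity (Function.update u i (!u i)) ≠ parity u := fun u i => by
    simp only [parity, ← add_sum_erase univ _ (mem_univ i), Function.update_self]
    rw [sum_congr rfl (g := fun j => if u j then (1 : ZMod 2) else 0) fun j hj => by
      rw [Function.update_of_ne (ne_of_mem_erase hj)]]
    cases u i <;> simp
  simpa only [ZMod.card] using (SimpleGraph.Coloring.mk parity fun {u _} ⟨i, h⟩ =>
    h ▸ (hflip u i).symm : (hypercubeGraph n).Coloring (ZMod 2)).colorable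

theorem isCubeLipschitz_iff_forall_adj {c : ℝ} (hc : 0 ≤ c) {f : Hypercube n → unitInterval} :
    IsCubeLipschitz c f ↔ ∀ u v, (hypercubeGraph n).Adj u v → |(f u : ℝ) - f v| ≤ c := by
  refine ⟨fun h u _ ⟨i, hi⟩ => ?_, fun h u i b => ?_⟩
  · rw [← hi, abs_sub_comm]
    exact h u i _
  · rcases Bool.eq_or_eq_not b (u i) with rfl | rfl
    · simpa only [Function.update_eq_self, sub_self, abs_zero] using hc
    · rw [abs_sub_comm]
      exact h u _ ⟨i, rfl⟩

theorem uniformCubeMeasure_real_isCubeLipschitz {c : ℝ} (hc : 0 ≤ c) :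
    (uniformCubeMeasure n).real {f | IsCubeLipschitz c f} = lipschitzProb (hypercubeGraph n) c := by
  simp only [isCubeLipschitz_iff_forall_adj hc]
  rfl

end Hypercube

theorem mainTheorem7 (c : ℝ) (hc : c ∈ Set.Ioo (0 : ℝ) 1) :
    ∃ e : ℕ → ℝ,
      Asymptotics.IsLittleO Filter.atTop e (fun n : ℕ => (2 : ℝ) ^ n) ∧
      ∀ n : ℕ, (uniformCubeMeasure n).real {f | IsCubeLipschitz c f} = c ^ ((2 : ℝ) ^ n + e n) := by
  have h := mainTheorem7_general (fun n => hypercubeGraph_isBipartite (n := n))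
    (fun n => hypercubeGraph_isRegularOfDegree (n := n)) tendsto_id hc
  simpa only [uniformCubeMeasure_real_isCubeLipschitz hc.1.le, Fintype.card_fun, Fintype.card_bool,
    Fintype.card_fin, Nat.cast_pow, Nat.cast_ofNat] using h
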